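/- **Setting.** Let $\mathfrak I$ be a finite index set with $m$ elements, and let $S\subset\mathbb R^m\otimes\mathbb R^3$ be open, with coordinates $(\vec x^{\,I})_{I\in\mathfrak I}$, $\vec x^{\,I}\in\mathbb R^3$. Let $N\to S$ be a principal $\mathbb R^m$-bundle with connection and with curvature $F_K$. Such a bundle is trivial, so $N=S\times\mathbb R^m$ with fibre coordinates $\psi_K$ and connection forms $d\psi_K+A_K$, where $A_K$ are smooth 1-forms on $S$ and $F_K=dA_K$. Let $(U_{IJ})$ (the Higgs field) be a smooth symmetric matrix-valued function on $S$ with $\det(U_{IJ})\neq0$ and $$\vec\partial_I U_{KJ}=\vec\partial_J U_{KI},\qquad F_K=\sum_{I,J}\tfrac12\,\vec\partial_J U_{KI}\cdot(d\vec x^{\,I}\wedge d\vec x^{\,J}),\qquad (d\vec x^{\,I}\wedge d\vec x^{\,J})_i=\varepsilon_{ijk}\,dx^I_j\wedge dx^J_k .$$ Repeated indices are summed. The extended Gibbons–Hawking hyperkähler structure on $N$ has the three Kähler forms $$\vec\Omega=-\tfrac12U_{IJ}\,d\vec x^{\,I}\wedge d\vec x^{\,J}-d\vec x^{\,K}\wedge(d\psi_K+A_K),$$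 the (possibly indefinite) metric $$g(v,w)=U_{IJ}\,d\vec x^{\,I}(v)\cdot d\vec x^{\,J}(w)+U^{IJ}(d\psi_I+A_I)(v)\,(d\psi_J+A_J)(w),$$ where $(U^{IJ})$ is the inverse matrix, and the complex structures $I_1,I_2,I_3$ with $\Omega_i(v,w)=g(v,I_iw)$. The collective (infinitesimal) $\mathbb H^\times/\mathbb Z_2$-action on the base is generated by $\vec L=-\vec x^{\,K}\times\vec\partial_K$ (rigid rotations) and $L_0=\vec x^{\,K}\cdot\vec\partial_K$ (simultaneous scalings). It *lifts to a hyperkähler cone structure on $N$* if there are smooth vector fields $X_0,X_1,X_2,X_3$ on $N$ that project to $L_0,L_1,L_2,L_3$ and are such that $E=2X_0$ is homothetic Euler, i.e. $\nabla_vE=v$ for every tangent vector $v$, with $\nabla$ the Levi-Civita connection of $g$, and $2X_i=-I_iE$ for $i=1,2,3$. **Proposition.** The collective $\mathbb H^\times/\mathbb Z_2$-action on the base lifts to a hyperkähler cone structure on $N$ if and only if, on $S$, for all $I,J$, $$\vec L\,U_{IJ}=\vec 0\qquad\text{and}\qquad L_0U_{IJ}=-U_{IJ}.$$ For every such lift,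 $[X_i,X_j]=\varepsilon_{ijk}X_k$ and $[X_i,X_0]=0$, and the hyperkähler potential of the cone structure is $$U=2\,U_{IJ}\,\vec x^{\,I}\cdot\vec x^{\,J},$$ that is, $\Omega_i=\tfrac12\,d(dU\circ I_i)$ for $i=1,2,3$, $dU=g(E,\cdot)$, and $U=\tfrac12g(E,E)$. If moreover $S$ is closed under the action $\vec x^{\,I}\mapsto\bar q\,\vec x^{\,I}q$ of $q\in\mathbb H^\times$ (vectors regarded as imaginary quaternions), then the two differential constraints hold if and only if $U_{IJ}$ is invariant under rigid rotations and homogeneous of degree $-1$ in the $\vec x^{\,I}$, i.e. $U_{IJ}(\bar q\,x\,q)=|q|^{-2}U_{IJ}(x)$ for all $q\in\mathbb H^\times$ and $x\in S$. -/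

import Mathlib

open scoped Matrix ContDiff Quaternion

noncomputable section

namespace ExtGH

/-- `ℝ^m ⊗ ℝ³`, the space of configurations `x = (x^I)` of `m` labelled points of `ℝ³`, where `m` is
the cardinality of the index type `ι`. The component `(x^I)_a` is `x I a`. -/
abbrev Base (ι : Type*) := ι → Fin 3 → ℝ

/-- `(ℝ^m ⊗ ℝ³) × ℝ^m`, with points (and tangent vectors) `(x, ψ)`. -/
abbrev Total (ι : Type*) := Base ι × (ι → ℝ)

/-- The `a`-th vector of the standard basis of `ℝ³`. -/
def e (a : Fin 3) : Fin 3 → ℝ := Pi.single a 1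

/-- The Levi-Civita symbol, `ε_{ijk} = (e_i × e_j)_k`. -/
def eps (i j k : Fin 3) : ℝ := (e i ⨯₃ e j) k

/-- The exterior derivative of a 1-form `α` on (an open subset of) a normed space, with the
convention `dα(v, w) = v(α(w)) - w(α(v))` for constant vector fields `v`, `w`. -/
def d₁ {E : Type*} [NormedAddCommGroup E] [NormedSpace ℝ E] (α : E → E → ℝ) (p v w : E) : ℝ :=
  fderiv ℝ (fun q => α q w) p v - fderiv ℝ (fun q => α q v) p w

section base

variable {ι : Type*} [Fintype ι] [DecidableEq ι]

/-- The partial derivative of `f` along the coordinate `(x^I)_a`. -/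
def pd (I : ι) (a : Fin 3) (f : Base ι → ℝ) (x : Base ι) : ℝ :=
  fderiv ℝ f x (Pi.single I (e a))

/-- `(dx^I ∧ dx^J)_l (v, w)`, where the wedge product of two `ℝ³`-valued 1-forms uses the
vector product: `(dx^I ∧ dx^J)_l = ε_{ljk} dx^I_j ∧ dx^J_k`, with `α ∧ β = α ⊗ β - β ⊗ α`. -/
def crossWedge (I J : ι) (l : Fin 3) (v w : Base ι) : ℝ :=
  (v I ⨯₃ w J) l - (w I ⨯₃ v J) l

/-- Generator of rotations, `L_i = -(x^K × ∂_K)_i`; as a vector field on `ℝ^m ⊗ ℝ³` its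
`I`-th component at `x` is `x^I × e_i`. -/
def rotField (i : Fin 3) (x : Base ι) : Base ι := fun I => x I ⨯₃ e i

/-- Generator of scalings, `L₀ = x^K · ∂_K`. -/
def scaleField (x : Base ι) : Base ι := x

/-- The action of a non-zero quaternion `q` on configurations, `x^I ↦ q̄ x^I q`, where vectors of `ℝ³`
are regarded as imaginary quaternions. It combines the rigid rotation by `q / |q|` and
the simultaneous scaling by `|q|²`. -/
def collectiveAct (q : ℍ[ℝ]) (x : Base ι) : Base ι := fun I =>
  let y : ℍ[ℝ] := star q * ⟨0, x I 0, x I 1, x I 2⟩ * q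
  ![y.imI, y.imJ, y.imK]

end base

/-- The data of an extended Gibbons-Hawking space over an open set `S ⊆ ℝ^m ⊗ ℝ³`. Principal
`ℝ^m`-bundles over `S` are trivial, because the fibre is contractible, so the total space is
`S × ℝ^m`, with fibre coordinates `ψ`, and a principal connection is `dψ_K + A_K` for an
`ℝ^m`-valued 1-form `A` on `S`, with curvature `F_K = dA_K`. -/
structure Data (ι : Type*) [Fintype ι] [DecidableEq ι] where
  /-- the open base -/
  S : Set (Base ι)
  isOpen_S : IsOpen S
  /-- the Higgs field `U_{IJ}` -/
  U : Base ι → Matrix ι ι ℝ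
  /-- the connection 1-forms `A_K` -/
  A : ι → Base ι → (Base ι →L[ℝ] ℝ)
  smooth_U : ∀ I J, ContDiffOn ℝ ∞ (fun x => U x I J) S
  smooth_A : ∀ K, ContDiffOn ℝ ∞ (A K) S
  symm_U : ∀ x ∈ S, (U x).IsSymm
  det_U : ∀ x ∈ S, (U x).det ≠ 0
  /-- first Bogomolny equation, `∂_I U_{KJ} = ∂_J U_{KI}` -/
  bogomolny₁ : ∀ x ∈ S, ∀ I J K a,
    pd I a (fun y => U y K J) x = pd J a (fun y => U y K I) x
  /-- second Bogomolny equation, `F_K = ⋆^I dU_{KI}`, where `⋆^I dx^J = ½ dx^I ∧ dx^J` -/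
  bogomolny₂ : ∀ x ∈ S, ∀ K v w,
    d₁ (fun y u => A K y u) x v w =
      ∑ I, ∑ J, ∑ l, pd J l (fun y => U y K I) x * (1 / 2 * crossWedge I J l v w)

namespace Data

variable {ι : Type*} [Fintype ι] [DecidableEq ι] (D : Data ι)

/-- The total space `N = S × ℝ^m`. -/
def N : Set (Total ι) := {p | p.1 ∈ D.S}

/-- The connection 1-form `η_K = dψ_K + A_K` on `N`. -/
def eta (K : ι) (p v : Total ι) : ℝ := v.2 K + D.A K p.1 v.1

/-- The raised connection form `U^{IJ} η_J`, with `U^{IJ}` the inverse matrix of `U_{IJ}`. -/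
def etaUp (I : ι) (p v : Total ι) : ℝ := ∑ J, (D.U p.1)⁻¹ I J * D.eta J p v

/-- The three 2-forms `Ω = -½ U_{IJ} dx^I ∧ dx^J - dx^K ∧ (dψ_K + A_K)`. -/
def Omega (i : Fin 3) (p v w : Total ι) : ℝ :=
  -(1 / 2) * ∑ I, ∑ J, D.U p.1 I J * crossWedge I J i v.1 w.1
    - ∑ K, (v.1 K i * D.eta K p w - w.1 K i * D.eta K p v)

/-- The (in general indefinite) hyperkähler metric
`½ U_{IJ} dx^I · dx^J + ½ U^{IJ} (dψ_I + A_I)(dψ_J + A_J)`, with the convention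
`α β = α ⊗ β + β ⊗ α` for the symmetric product of 1-forms. -/
def metric (p v w : Total ι) : ℝ :=
  ∑ I, ∑ J, D.U p.1 I J * (v.1 I ⬝ᵥ w.1 J)
    + ∑ I, ∑ J, (D.U p.1)⁻¹ I J * (D.eta I p v * D.eta J p w)

/-- The three complex structures. In terms of the quaternionic coframe
`H^I = U^{IJ} η_J + dx^I`, with components `etaUp` and `dx^I`, they are `H^I(I_i w) = -H^I(w) u_i`,
with `u_i` the imaginary units. They are the endomorphisms with `Ω_i(v, w) = g(v, I_i w)`. -/
def cplx (i : Fin 3) (p w : Total ι) : Total ι :=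
  let y : Base ι := fun I => (e i ⨯₃ w.1 I) - D.etaUp I p w • e i
  (y, fun K => ∑ J, D.U p.1 K J * w.1 J i - D.A K p.1 y)

/-- `g(∇_v X, z)` at `p`, with `∇` the Levi-Civita connection of the metric and `v`, `z` constant vector
fields on `N` (Koszul formula in coordinates: the first-kind Christoffel symbols are added to the
derivative of `X` along `v`). -/
def covDeriv (X : Total ι → Total ι) (p v z : Total ι) : ℝ :=
  D.metric p (fderiv ℝ X p v) z
    + 1 / 2 * (fderiv ℝ (fun q => D.metric q (X p) z) p v
      + fderiv ℝ (fun q => D.metric q v z) p (X p)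
      - fderiv ℝ (fun q => D.metric q v (X p)) p z)

/-- The vector field `X` on `N` is homothetic Euler: `∇_v X = v` for all `v`. -/
def IsHomotheticEuler (X : Total ι → Total ι) : Prop :=
  ∀ p ∈ D.N, ∀ v z, D.covDeriv X p v z = D.metric p v z

/-- The smooth vector fields `X₀, X₁, X₂, X₃` on `N` are lifts of the generators
`L₀, L₁, L₂, L₃` of the collective transformations, i.e. they project to them. -/
structure IsLift (X₀ : Total ι → Total ι) (X : Fin 3 → Total ι → Total ι) : Prop where
  smooth_zero : ContDiffOn ℝ ∞ X₀ D.N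
  smooth : ∀ i, ContDiffOn ℝ ∞ (X i) D.N
  proj_zero : ∀ p ∈ D.N, (X₀ p).1 = scaleField p.1
  proj : ∀ i, ∀ p ∈ D.N, (X i p).1 = rotField i p.1

/-- `X₀, X₁, X₂, X₃` generate a hyperkähler cone structure on `N`: `2 X₀` is a homothetic Euler
vector field `E` and `2 X_i = -I_i E` are its three rotational companions. The factor 2 is the
normalization `[L_i, L_j] = ε_{ijk} L_k` as opposed to
`[E_i, E_j] = 2 ε_{ijk} E_k` for `E_i = -I_i E`. -/
structure GeneratesCone (X₀ : Total ι → Total ι) (X : Fin 3 → Total ι → Total ι) : Prop where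
  euler : D.IsHomotheticEuler (fun p => (2 : ℝ) • X₀ p)
  companion : ∀ i, ∀ p ∈ D.N, X i p = -D.cplx i p (X₀ p)

/-- The commutation relations `[X_i, X_j] = ε_{ijk} X_k`, `[X_i, X₀] = 0` of the Lie algebra of
`ℍˣ / ℤ₂` on `N`. -/
def SatisfiesAlgebra (X₀ : Total ι → Total ι) (X : Fin 3 → Total ι → Total ι) : Prop :=
  ∀ p ∈ D.N,
    (∀ i j, VectorField.lieBracket ℝ (X i) (X j) p = ∑ k, eps i j k • X k p) ∧
    (∀ i, VectorField.lieBracket ℝ (X i) X₀ p = 0)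

/-- `κ` is a hyperkähler potential: it is a Kähler potential for each of the three Kähler forms
with respect to its complex structure, `Ω_i = ½ d(dκ I_i)`. -/
def IsHyperkahlerPotential (κ : Total ι → ℝ) : Prop :=
  ContDiffOn ℝ ∞ κ D.N ∧
  ∀ i, ∀ p ∈ D.N, ∀ v w,
    D.Omega i p v w = 1 / 2 * d₁ (fun q u => fderiv ℝ κ q (D.cplx i q u)) p v w

/-- `κ` is the hyperkähler potential of the cone structure with homothetic Euler vector field `E`:
it is a hyperkähler potential with gradient `E`, normalized as `κ = ½ g(E, E)`. -/
def IsPotentialOfCone (E : Total ι → Total ι) (κ : Total ι → ℝ) : Prop :=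
  D.IsHyperkahlerPotential κ ∧
  (∀ p ∈ D.N, ∀ v, fderiv ℝ κ p v = D.metric p (E p) v) ∧
  (∀ p ∈ D.N, κ p = 1 / 2 * D.metric p (E p) (E p))

/-- The linear differential constraints on the Higgs field, `L_i U_{IJ} = 0` and
`L₀ U_{IJ} = -U_{IJ}`. -/
def HiggsConstraints : Prop :=
  ∀ x ∈ D.S, ∀ I J,
    (∀ i, fderiv ℝ (fun y => D.U y I J) x (rotField i x) = 0) ∧
    fderiv ℝ (fun y => D.U y I J) x (scaleField x) = -D.U x I J

/-- The base is closed under the collective action. -/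
def BaseInvariant : Prop :=
  ∀ q : ℍ[ℝ], q ≠ 0 → ∀ x ∈ D.S, collectiveAct q x ∈ D.S

/-- Under the collective action the Higgs field is rotation-invariant and homogeneous of degree `-1`
(`q` scales the vectors `x^I` by `|q|²`). -/
def HiggsEquivariant : Prop :=
  ∀ q : ℍ[ℝ], q ≠ 0 → ∀ x ∈ D.S, D.U (collectiveAct q x) = (‖q‖ ^ 2)⁻¹ • D.U x

/-- The function `2 U_{IJ} x^I · x^J`, pulled back to `N`. -/
def potential (p : Total ι) : ℝ :=
  2 * ∑ I, ∑ J, D.U p.1 I J * (p.1 I ⬝ᵥ p.1 J)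

/-- On `N` the complex structures are characterized by `Ω_i(v, w) = g(v, I_i w)`. -/
theorem Omega_eq_metric_cplx (i : Fin 3) {p : Total ι} (hp : p ∈ D.N) (v w : Total ι) :
    D.Omega i p v w = D.metric p v (D.cplx i p w) := by
  have hs : ∀ I J, D.U p.1 J I = D.U p.1 I J := fun I J => (D.symm_U p.1 hp).apply I J
  have hdet : IsUnit (D.U p.1).det := isUnit_iff_ne_zero.2 (D.det_U p.1 hp)
  have hinv : (D.U p.1)⁻¹ * D.U p.1 = 1 := Matrix.nonsing_inv_mul _ hdet
  have hinv' : D.U p.1 * (D.U p.1)⁻¹ = 1 := Matrix.mul_nonsing_inv _ hdet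
  have h1 : ∀ K, D.eta K p (D.cplx i p w) = ∑ J, D.U p.1 K J * w.1 J i := by
    intro K
    simp [eta, cplx]
  have h2 : ∀ I, ∑ J, D.U p.1 I J * D.etaUp J p w = D.eta I p w := by
    intro I
    have := congrFun (congrArg (fun M : Matrix ι ι ℝ => M *ᵥ fun J => D.eta J p w) hinv') I
    simp only [← Matrix.mulVec_mulVec, Matrix.one_mulVec] at this
    exact this
  have h3 : ∀ I, ∑ J, (D.U p.1)⁻¹ I J * ∑ L, D.U p.1 J L * w.1 L i = w.1 I i := by
    intro I
    have := congrFun (congrArg (fun M : Matrix ι ι ℝ => M *ᵥ fun J => w.1 J i) hinv) I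
    simp only [← Matrix.mulVec_mulVec, Matrix.one_mulVec] at this
    exact this
  have h4 : ∀ I J, v.1 I ⬝ᵥ (D.cplx i p w).1 J
      = -(v.1 I ⨯₃ w.1 J) i - D.etaUp J p w * v.1 I i := by
    intro I J
    fin_cases i <;> simp [cplx, e, cross_apply, dotProduct, Fin.sum_univ_three,
      Matrix.vecHead, Matrix.vecTail] <;> ring
  have h5 : ∑ I, ∑ J, D.U p.1 I J * (w.1 I ⨯₃ v.1 J) i
      = -∑ I, ∑ J, D.U p.1 I J * (v.1 I ⨯₃ w.1 J) i := by
    rw [Finset.sum_comm, ← Finset.sum_neg_distrib]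
    refine Finset.sum_congr rfl fun I _ => ?_
    rw [← Finset.sum_neg_distrib]
    refine Finset.sum_congr rfl fun J _ => ?_
    rw [hs, ← cross_anticomm, Pi.neg_apply]
    ring
  have h6 : ∑ I, ∑ J, D.U p.1 I J * (D.etaUp J p w * v.1 I i)
      = ∑ I, v.1 I i * D.eta I p w := by
    refine Finset.sum_congr rfl fun I _ => ?_
    rw [← h2, Finset.mul_sum]
    exact Finset.sum_congr rfl fun J _ => by ring
  have h7 : ∑ I, ∑ J, (D.U p.1)⁻¹ I J * (D.eta I p v * D.eta J p (D.cplx i p w))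
      = ∑ I, w.1 I i * D.eta I p v := by
    refine Finset.sum_congr rfl fun I _ => ?_
    rw [← h3, Finset.sum_mul]
    exact Finset.sum_congr rfl fun J _ => by rw [h1]; ring
  rw [metric, h7, Omega]
  simp only [h4, crossWedge, mul_sub, Finset.sum_sub_distrib, mul_neg, Finset.sum_neg_distrib,
    h5, h6]
  ring

/-- The metric is non-degenerate on `N`. -/
theorem metric_nondegenerate {p : Total ι} (hp : p ∈ D.N) (v : Total ι)
    (hv : ∀ w, D.metric p w v = 0) : v = 0 := by
  have hdet : IsUnit (D.U p.1).det := isUnit_iff_ne_zero.2 (D.det_U p.1 hp)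
  have hinv : (D.U p.1)⁻¹ * D.U p.1 = 1 := Matrix.nonsing_inv_mul _ hdet
  have hinv' : D.U p.1 * (D.U p.1)⁻¹ = 1 := Matrix.mul_nonsing_inv _ hdet
  have hz : ∀ K, D.eta K p v = 0 := by
    have hw : ∀ I, ∑ J, (D.U p.1)⁻¹ I J * D.eta J p v = 0 := by
      intro I
      have := hv (0, Pi.single I 1)
      simpa [metric, eta, Pi.single_apply] using this
    intro K
    have := congrFun (congrArg (fun M : Matrix ι ι ℝ => M *ᵥ fun J => D.eta J p v) hinv') K
    rw [← Matrix.mulVec_mulVec,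
      show ((D.U p.1)⁻¹ *ᵥ fun J => D.eta J p v) = 0 from funext hw] at this
    simpa using this.symm
  have hx : ∀ a, (fun J => v.1 J a) = 0 := by
    intro a
    have hw : (D.U p.1 *ᵥ fun J => v.1 J a) = 0 := by
      funext I
      have := hv (Pi.single I (e a), 0)
      simp only [metric, hz, mul_zero, Finset.sum_const_zero, add_zero] at this
      rw [Finset.sum_eq_single I (fun K _ hK => by simp [hK]) (by simp)] at this
      simpa [e, Matrix.mulVec, dotProduct, Pi.single_apply] using this
    have := congrArg (fun y => (D.U p.1)⁻¹ *ᵥ y) hw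
    simpa [Matrix.mulVec_mulVec, hinv] using this
  have hx' : v.1 = 0 := by
    funext J a
    exact congrFun (hx a) J
  refine Prod.ext hx' (funext fun K => ?_)
  simpa [eta, hx'] using hz K

end Data
end ExtGH

end

/-!
# The conical symmetry of extended Gibbons–Hawking spaces

Since `X_i = -I_i X₀` has to project to the rotation `L_i`, the components `U^{IJ} η_J(X₀)` vanish, so
that `X₀` can only be the horizontal lift `scaleLift` of the generator `L₀` of scalings, and `X_i` the
field `rotLift i` with `η_K(X_i) = -U_{KJ} x^J_i`. In particular a lift is unique, and everything is a
statement about these explicit fields.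

For `E = 2 X₀` the Koszul formula gives (`covDeriv_scaleLift`)
`g(∇_v E, z) = U_{IJ} (2 v^I · z^J) + (L₀ U_{IJ}) v^I · z^J + d(U_{IJ} x^I · dx^J)(v, z)
  + (L₀ U^{IJ}) η_I(v) η_J(z) + U^{IJ} (F_I(L₀, v) η_J(z) + η_I(v) F_J(L₀, z))`.
By the Bogomolny equations both the exterior derivative and `F_K(L₀, ·)` are combinations of the
rotational derivatives `L_i U_{IJ}`, and `L₀ U_{IJ} = -U_{IJ}` implies `L₀ U^{IJ} = U^{IJ}`; hence
the constraints imply that `E` is homothetic Euler. Conversely, on horizontal vectors the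
part of `g(∇_v E, z) = g(v, z)` symmetric in `v` and `z` is `L₀ U_{IJ} = -U_{IJ}`, and the antisymmetric
part is `L_i U_{IJ} = 0`.

The gradient `∂U_{IJ} / ∂(x^K)_a` is symmetric in all of `I`, `J`, `K`, and the constraints say that its
moments `x^K_a ∂_{Kb} U_{IJ}` are symmetric `3 × 3` matrices with trace `-U_{IJ}`. The commutation
relations reduce to the values of the curvature on the generators (`curv_scaleField`,
`curv_rotField`), and the potential to `dκ = g(E, ·)` (`fderiv_potential`), which gives
`dκ I_i = Ω_i(E, ·)`, and to an identity for `3 × 3` matrices (`sum_dU_cross`).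

For the integrated form of the constraints, the derivative of `q ↦ |q|² U_{IJ}(q̄ x q)` in the
direction `q k` is a linear combination of `U_{IJ} + L₀ U_{IJ}` and `L_i U_{IJ}` at the point `q̄ x q`
(`hasFDerivAt_normSq_mul_U`). So the constraints hold iff this function is constant on the connected
set `ℍ \ {0}`.
-/

open scoped Matrix ContDiff Quaternion

noncomputable section

namespace ExtGH

/-! ### The derivatives of the Higgs field and the curvature -/

theorem base_eq_sum {ι : Type*} [Fintype ι] [DecidableEq ι] (v : Base ι) :
    v = ∑ K, ∑ a, v K a • (Pi.single K (e a) : Base ι) := by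
  funext K a
  simp [Finset.sum_apply, e, Pi.single_apply, ite_apply]

namespace Data

variable {ι : Type*} [Fintype ι] [DecidableEq ι] (D : Data ι)

theorem isOpen_N : IsOpen D.N := D.isOpen_S.preimage continuous_fst

/-- The directional derivative `∂_v U_{IJ}` of the Higgs field. -/
def dU (x v : Base ι) : Matrix ι ι ℝ := fun I J => fderiv ℝ (fun y => D.U y I J) x v

/-- The directional derivative `∂_v U^{IJ}` of the inverse of the Higgs field. -/
def dUinv (x v : Base ι) : Matrix ι ι ℝ := fun I J => fderiv ℝ (fun y => (D.U y)⁻¹ I J) x v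

/-- The partial derivatives `∂U_{IJ} / ∂(x^K)_a` of the Higgs field. -/
def grad (x : Base ι) (I J K : ι) (a : Fin 3) : ℝ := pd K a (fun y => D.U y I J) x

/-- The curvature `F_K(v, w)` of the connection. -/
def curv (K : ι) (x v w : Base ι) : ℝ := fderiv ℝ (D.A K) x v w - fderiv ℝ (D.A K) x w v

/-- The moments `x^K_a ∂_{Kb} U_{IJ}` of the gradient of the Higgs field. -/
def moment (x : Base ι) (I J : ι) (a b : Fin 3) : ℝ := ∑ K, x K a * D.grad x I J K b

section

variable {D} {x : Base ι} (hx : x ∈ D.S)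
include hx

theorem differentiableAt_U (I J : ι) : DifferentiableAt ℝ (fun y => D.U y I J) x :=
  ((D.smooth_U I J).contDiffAt (D.isOpen_S.mem_nhds hx)).differentiableAt (by simp)

theorem differentiableAt_A (K : ι) : DifferentiableAt ℝ (D.A K) x :=
  ((D.smooth_A K).contDiffAt (D.isOpen_S.mem_nhds hx)).differentiableAt (by simp)

theorem U_comm (I J : ι) : D.U x I J = D.U x J I := (D.symm_U x hx).apply J I

theorem isUnit_det : IsUnit (D.U x).det := isUnit_iff_ne_zero.2 (D.det_U x hx)

theorem differentiableAt_Uinv (I J : ι) : DifferentiableAt ℝ (fun y => (D.U y)⁻¹ I J) x := by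
  have hU := fun I J => differentiableAt_U hx I J
  have hd : ∀ M : Base ι → Matrix ι ι ℝ, (∀ I J, DifferentiableAt ℝ (fun y => M y I J) x) →
      DifferentiableAt ℝ (fun y => (M y).det) x := by
    intro M hM
    simp only [Matrix.det_apply]
    exact DifferentiableAt.fun_sum fun σ _ => DifferentiableAt.const_smul
      (HasFDerivAt.finsetProd fun I _ => (hM _ _).hasFDerivAt).differentiableAt _
  -- Cramer's rule
  have h : (fun y => (D.U y)⁻¹ I J)
      = fun y => ((D.U y).det)⁻¹ * ((D.U y).updateRow J (Pi.single I 1)).det := by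
    funext y
    rw [Matrix.inv_def, Ring.inverse_eq_inv', Matrix.smul_apply, Matrix.adjugate_apply, smul_eq_mul]
  rw [h]
  refine ((hd _ hU).inv (D.det_U x hx)).mul (hd _ fun K L => ?_)
  by_cases hK : K = J
  · subst hK
    simp
  · simpa [Matrix.updateRow_ne hK] using hU K L

theorem dU_comm (v : Base ι) (I J : ι) : D.dU x v I J = D.dU x v J I := by
  refine congrArg (fun L : Base ι →L[ℝ] ℝ => L v) (Filter.EventuallyEq.fderiv_eq ?_)
  filter_upwards [D.isOpen_S.mem_nhds hx] with y hy using U_comm hy I J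

theorem grad_comm (I J K : ι) (a : Fin 3) : D.grad x I J K a = D.grad x J I K a :=
  dU_comm hx _ I J

/-- The first Bogomolny equation: together with `grad_comm` it makes the gradient symmetric in all
three indices. -/
theorem grad_comm' (I J K : ι) (a : Fin 3) : D.grad x I J K a = D.grad x I K J a :=
  D.bogomolny₁ x hx K J I a

theorem grad_swap (I J K : ι) (a : Fin 3) : D.grad x I J K a = D.grad x K J I a := by
  rw [grad_comm hx, grad_comm' hx, grad_comm hx]

theorem moment_comm (I J : ι) (a b : Fin 3) : D.moment x I J a b = D.moment x J I a b :=
  Finset.sum_congr rfl fun K _ => by rw [grad_comm hx]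

end

theorem dU_eq_sum (x v : Base ι) (I J : ι) :
    D.dU x v I J = ∑ K, ∑ a, v K a * D.grad x I J K a := by
  conv_lhs => rw [base_eq_sum v]
  simp [dU, grad, pd, map_sum]

theorem dU_scaleField (x : Base ι) (I J : ι) :
    D.dU x x I J = ∑ a, D.moment x I J a a := by
  rw [dU_eq_sum, Finset.sum_comm]
  rfl

theorem dU_rotField (x : Base ι) (i : Fin 3) (I J : ι) :
    D.dU x (rotField i x) I J = ∑ a, ∑ b, (e a ⨯₃ e i) b * D.moment x I J a b := by
  rw [dU_eq_sum]
  simp only [moment, Finset.mul_sum]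
  simp only [Fin.sum_univ_three, ← Finset.sum_add_distrib]
  refine Finset.sum_congr rfl fun K _ => ?_
  fin_cases i <;> simp [rotField, e, cross_apply] <;> ring

/-- The Higgs field is rotation invariant iff the moments of its gradient are symmetric. -/
theorem dU_rotField_eq_zero_iff (x : Base ι) (I J : ι) :
    (∀ i, D.dU x (rotField i x) I J = 0) ↔ ∀ a b, D.moment x I J a b = D.moment x I J b a := by
  simp only [dU_rotField]
  constructor
  · intro h a b
    have h0 := h 0
    have h1 := h 1
    have h2 := h 2
    simp [Fin.sum_univ_three, e, cross_apply] at h0 h1 h2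
    fin_cases a <;> fin_cases b <;> simp <;> linarith
  · intro h i
    have h0 := h 0 1
    have h1 := h 0 2
    have h2 := h 1 2
    fin_cases i <;> simp [Fin.sum_univ_three, e, cross_apply] <;> linarith

section

variable {D} {x : Base ι} (hx : x ∈ D.S)
include hx

/-- Moves the differentiation index of the gradient to a free slot, by total symmetry, so that only
moments of the gradient appear. -/
theorem sum_dU_dot (v z : Base ι) :
    ∑ I, ∑ J, D.dU x v I J * (x I ⬝ᵥ z J)
      = ∑ K, ∑ J, ∑ a, ∑ b, v K a * z J b * D.moment x K J b a := by
  have h : ∀ I J, D.dU x v I J * (x I ⬝ᵥ z J)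
      = ∑ K, ∑ a, ∑ b, v K a * z J b * (x I b * D.grad x K J I a) := by
    intro I J
    rw [dU_eq_sum, Finset.sum_mul]
    refine Finset.sum_congr rfl fun K _ => ?_
    rw [Finset.sum_mul]
    refine Finset.sum_congr rfl fun a _ => ?_
    rw [dotProduct, Finset.mul_sum, grad_swap hx]
    exact Finset.sum_congr rfl fun b _ => by ring
  have h' : ∀ K J, ∑ a, ∑ b, v K a * z J b * D.moment x K J b a
      = ∑ I, ∑ a, ∑ b, v K a * z J b * (x I b * D.grad x K J I a) := by
    intro K J
    simp only [moment, Finset.mul_sum, Fin.sum_univ_three, Finset.sum_add_distrib]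
  simp only [h, h']
  rw [Finset.sum_congr rfl fun I _ => Finset.sum_comm, Finset.sum_comm]
  exact Finset.sum_congr rfl fun K _ => Finset.sum_comm

/-- The Higgs field contributes the antisymmetric part of its moments to the exterior derivative of
`U_{IJ} x^I · dx^J`. -/
theorem sum_dU_dot_sub (v z : Base ι) :
    ∑ I, ∑ J, (D.dU x v I J * (x I ⬝ᵥ z J) - D.dU x z I J * (v I ⬝ᵥ x J))
      = ∑ K, ∑ J, ∑ a, ∑ b, v K a * z J b * (D.moment x K J b a - D.moment x K J a b) := by
  have h : ∑ I, ∑ J, D.dU x z I J * (v I ⬝ᵥ x J) = ∑ I, ∑ J, D.dU x z I J * (x I ⬝ᵥ v J) := by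
    rw [Finset.sum_comm]
    refine Finset.sum_congr rfl fun I _ => Finset.sum_congr rfl fun J _ => ?_
    rw [dU_comm hx, dotProduct_comm]
  simp only [Finset.sum_sub_distrib, mul_sub]
  rw [h, sum_dU_dot hx, sum_dU_dot hx, Finset.sum_comm (f := fun K J => ∑ a, ∑ b,
    z K a * v J b * D.moment x K J b a)]
  refine congrArg₂ (· - ·) rfl (Finset.sum_congr rfl fun K _ => Finset.sum_congr rfl fun J _ => ?_)
  rw [Finset.sum_comm]
  refine Finset.sum_congr rfl fun a _ => Finset.sum_congr rfl fun b _ => ?_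
  rw [moment_comm hx]
  ring

theorem d₁_A (K : ι) (v w : Base ι) : d₁ (fun y u => D.A K y u) x v w = D.curv K x v w := by
  have h : ∀ u, HasFDerivAt (fun y => D.A K y u)
      ((ContinuousLinearMap.apply ℝ ℝ u).comp (fderiv ℝ (D.A K) x)) x := fun u =>
    (ContinuousLinearMap.apply ℝ ℝ u).hasFDerivAt.comp x (differentiableAt_A hx K).hasFDerivAt
  rw [d₁, (h v).fderiv, (h w).fderiv]
  rfl

/-- By the first Bogomolny equation the two halves of the wedge product contribute equally. -/
theorem curv_eq_sum (K : ι) (v w : Base ι) :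
    D.curv K x v w = ∑ I, ∑ J, ∑ l, D.grad x K I J l * (v I ⨯₃ w J) l := by
  rw [← d₁_A hx, D.bogomolny₂ x hx]
  have h : ∑ I, ∑ J, ∑ l, D.grad x K I J l * (w I ⨯₃ v J) l
      = -∑ I, ∑ J, ∑ l, D.grad x K I J l * (v I ⨯₃ w J) l := by
    rw [Finset.sum_comm]
    simp only [← Finset.sum_neg_distrib]
    refine Finset.sum_congr rfl fun I _ => Finset.sum_congr rfl fun J _ =>
      Finset.sum_congr rfl fun l _ => ?_
    rw [grad_comm' hx, ← cross_anticomm, Pi.neg_apply, mul_neg]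
  have h' : ∀ I J l, pd J l (fun y => D.U y K I) x * (1 / 2 * crossWedge I J l v w)
      = 1 / 2 * (D.grad x K I J l * (v I ⨯₃ w J) l)
        - 1 / 2 * (D.grad x K I J l * (w I ⨯₃ v J) l) := by
    intro I J l
    rw [grad, crossWedge]
    ring
  simp only [h', Finset.sum_sub_distrib, ← Finset.mul_sum, h]
  ring

/-- Contracting the curvature with the generator of scalings gives the rotational derivatives of the
Higgs field. -/
theorem curv_scaleField (K : ι) (w : Base ι) :
    D.curv K x x w = ∑ J, ∑ l, w J l * D.dU x (rotField l x) K J := by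
  rw [curv_eq_sum hx, Finset.sum_comm]
  refine Finset.sum_congr rfl fun J _ => ?_
  simp only [dU_eq_sum, Fin.sum_univ_three, Finset.mul_sum, ← Finset.sum_add_distrib]
  refine Finset.sum_congr rfl fun I _ => ?_
  rw [grad_comm' hx K I J, grad_comm' hx K I J, grad_comm' hx K I J]
  simp [rotField, e, cross_apply]
  ring

theorem curv_scaleField_eq_zero (h : D.HiggsConstraints) (K : ι) (w : Base ι) :
    D.curv K x x w = 0 := by
  rw [curv_scaleField hx]
  exact Finset.sum_eq_zero fun J _ => Finset.sum_eq_zero fun l _ => by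
    rw [show D.dU x (rotField l x) K J = 0 from (h x hx K J).1 l, mul_zero]

theorem sum_U_cross_swap (i : Fin 3) (v w : Base ι) :
    ∑ I, ∑ J, D.U x I J * (w I ⨯₃ v J) i = -∑ I, ∑ J, D.U x I J * (v I ⨯₃ w J) i := by
  rw [Finset.sum_comm]
  simp only [← Finset.sum_neg_distrib]
  refine Finset.sum_congr rfl fun I _ => Finset.sum_congr rfl fun J _ => ?_
  rw [U_comm hx, ← cross_anticomm, Pi.neg_apply, mul_neg]

/-- If the Higgs field is homogeneous of degree `-1`, then its inverse is homogeneous of degree `1`,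
by differentiation of `U U⁻¹ = 1`. -/
theorem dUinv_scaleField (h : ∀ I J, D.dU x x I J = -D.U x I J) (I J : ι) :
    D.dUinv x x I J = (D.U x)⁻¹ I J := by
  have hdet := isUnit_det hx
  have hone : ∀ I J, ∑ K, (D.dU x x I K * (D.U x)⁻¹ K J + D.U x I K * D.dUinv x x K J) = 0 := by
    intro I J
    have h1 : HasFDerivAt (fun y => ∑ K, D.U y I K * (D.U y)⁻¹ K J) _ x :=
      HasFDerivAt.fun_sum fun K _ => (differentiableAt_U hx I K).hasFDerivAt.mul
        (differentiableAt_Uinv hx K J).hasFDerivAt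
    have h2 : (fun y => ∑ K, D.U y I K * (D.U y)⁻¹ K J) =ᶠ[nhds x]
        fun _ => (1 : Matrix ι ι ℝ) I J := by
      filter_upwards [D.isOpen_S.mem_nhds hx] with y hy
      rw [← Matrix.mul_apply, Matrix.mul_nonsing_inv _ (isUnit_det hy)]
    have h3 := congrArg (fun L => L x) (h2.fderiv_eq.symm.trans h1.fderiv)
    simp only [fderiv_fun_const, sum_apply] at h3
    refine Eq.trans (Finset.sum_congr rfl fun K _ => ?_) h3.symm
    simp only [dU, dUinv, add_apply, smul_apply, smul_eq_mul]
    ring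
  have hU : D.U x * D.dUinv x x = 1 := by
    ext I J
    have := hone I J
    simp only [h, neg_mul, Finset.sum_add_distrib, Finset.sum_neg_distrib, ← Matrix.mul_apply,
      Matrix.mul_nonsing_inv _ hdet] at this
    linarith
  rw [Matrix.inv_eq_right_inv hU]

end

end Data

/-! ### The horizontal lift of the scalings -/

namespace Data

variable {ι : Type*} [Fintype ι] [DecidableEq ι] (D : Data ι)

/-- The horizontal lift of the generator of scalings. -/
def scaleLift (p : Total ι) : Total ι := (p.1, fun K => -D.A K p.1 p.1)

/-- The lift of the `i`-th generator of rotations with vertical part `η_K = -U_{KJ} x^J_i`. -/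
def rotLift (i : Fin 3) (p : Total ι) : Total ι :=
  (rotField i p.1, fun K => -∑ J, D.U p.1 K J * p.1 J i - D.A K p.1 (rotField i p.1))

theorem eta_scaleLift (K : ι) (p : Total ι) : D.eta K p (D.scaleLift p) = 0 := by
  simp [eta, scaleLift]

theorem eta_two_smul_scaleLift (K : ι) (p : Total ι) :
    D.eta K p ((2 : ℝ) • D.scaleLift p) = 0 := by
  simp [eta, scaleLift]

theorem neg_cplx_scaleLift (i : Fin 3) (p : Total ι) :
    -D.cplx i p (D.scaleLift p) = D.rotLift i p := by
  have h : ∀ I, D.etaUp I p (D.scaleLift p) = 0 := by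
    intro I
    simp [etaUp, eta_scaleLift]
  have h' : (D.cplx i p (D.scaleLift p)).1 = -rotField i p.1 := by
    funext I
    simp only [cplx, h, zero_smul, sub_zero]
    simp [scaleLift, rotField]
  have h2 : ∀ K, (D.cplx i p (D.scaleLift p)).2 K
      = ∑ J, D.U p.1 K J * p.1 J i - D.A K p.1 (D.cplx i p (D.scaleLift p)).1 := fun K => rfl
  refine Prod.ext ?_ (funext fun K => ?_)
  · rw [Prod.fst_neg, h', neg_neg]
    rfl
  · rw [Prod.snd_neg, Pi.neg_apply, h2, h']
    simp [rotLift]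
    ring

section

variable {D} {p : Total ι} (hp : p ∈ D.N)
include hp

/-- The horizontal lift of the generator of scalings is the only lift whose companions project to
the generators of rotations. -/
theorem eq_scaleLift_of_cplx {w : Total ι} (hw : w.1 = p.1)
    (h : ∀ i, (-D.cplx i p w).1 = rotField i p.1) : w = D.scaleLift p := by
  -- the `e₀`-component of the zeroth companion is `etaUp`, that of `x^I × e₀` is zero
  have hup : ∀ I, D.etaUp I p w = 0 := by
    intro I
    have := congrFun (congrFun (h 0) I) 0
    simpa [cplx, hw, rotField, e, cross_apply, Matrix.vecHead] using this
  have heta : ∀ K, D.eta K p w = 0 := by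
    intro K
    have := congrFun (congrArg (fun M : Matrix ι ι ℝ => M *ᵥ fun J => D.eta J p w)
      (Matrix.mul_nonsing_inv _ (isUnit_det hp))) K
    rw [← Matrix.mulVec_mulVec,
      show ((D.U p.1)⁻¹ *ᵥ fun J => D.eta J p w) = 0 from funext hup] at this
    simpa using this.symm
  refine Prod.ext hw (funext fun K => ?_)
  have := heta K
  rw [eta, hw] at this
  simpa [scaleLift] using eq_neg_of_add_eq_zero_left this

theorem hasFDerivAt_U (I J : ι) : HasFDerivAt (fun q : Total ι => D.U q.1 I J)
    ((fderiv ℝ (fun y => D.U y I J) p.1).comp (ContinuousLinearMap.fst ℝ _ _)) p :=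
  (differentiableAt_U hp I J).hasFDerivAt.comp p hasFDerivAt_fst

theorem hasFDerivAt_Uinv (I J : ι) : HasFDerivAt (fun q : Total ι => (D.U q.1)⁻¹ I J)
    ((fderiv ℝ (fun y => (D.U y)⁻¹ I J) p.1).comp (ContinuousLinearMap.fst ℝ _ _)) p :=
  (differentiableAt_Uinv hp I J).hasFDerivAt.comp p hasFDerivAt_fst

theorem hasFDerivAt_A (K : ι) : HasFDerivAt (fun q : Total ι => D.A K q.1)
    ((fderiv ℝ (D.A K) p.1).comp (ContinuousLinearMap.fst ℝ _ _)) p :=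
  (differentiableAt_A hp K).hasFDerivAt.comp p hasFDerivAt_fst

theorem hasFDerivAt_eta (K : ι) (v : Total ι) : HasFDerivAt (fun q => D.eta K q v)
    (((ContinuousLinearMap.apply ℝ ℝ v.1).comp (fderiv ℝ (D.A K) p.1)).comp
      (ContinuousLinearMap.fst ℝ _ _)) p :=
  (((ContinuousLinearMap.apply ℝ ℝ v.1).hasFDerivAt.comp p (hasFDerivAt_A hp K)).const_add _)

theorem fderiv_metric (a b c : Total ι) :
    fderiv ℝ (fun q => D.metric q a b) p c =
      ∑ I, ∑ J, D.dU p.1 c.1 I J * (a.1 I ⬝ᵥ b.1 J)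
      + ∑ I, ∑ J, (D.dUinv p.1 c.1 I J * (D.eta I p a * D.eta J p b)
        + (D.U p.1)⁻¹ I J * (fderiv ℝ (D.A I) p.1 c.1 a.1 * D.eta J p b
          + D.eta I p a * fderiv ℝ (D.A J) p.1 c.1 b.1)) := by
  have h : HasFDerivAt (fun q => D.metric q a b) _ p := HasFDerivAt.fun_add
    (HasFDerivAt.fun_sum fun I _ => HasFDerivAt.fun_sum fun J _ =>
      (hasFDerivAt_U hp I J).mul_const (a.1 I ⬝ᵥ b.1 J))
    (HasFDerivAt.fun_sum fun I _ => HasFDerivAt.fun_sum fun J _ =>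
      (hasFDerivAt_Uinv hp I J).mul
        ((hasFDerivAt_eta hp I a).mul (hasFDerivAt_eta hp J b)))
  rw [h.fderiv]
  simp only [add_apply, sum_apply, smul_apply, smul_eq_mul]
  refine congrArg₂ (· + ·) (Finset.sum_congr rfl fun I _ => Finset.sum_congr rfl fun J _ => ?_)
    (Finset.sum_congr rfl fun I _ => Finset.sum_congr rfl fun J _ => ?_)
  · simp [dU]
    ring
  · simp [dUinv]
    ring

theorem hasFDerivAt_scaleLift : HasFDerivAt D.scaleLift
    ((ContinuousLinearMap.fst ℝ (Base ι) (ι → ℝ)).prod (ContinuousLinearMap.pi fun K =>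
      -((D.A K p.1).comp (ContinuousLinearMap.fst ℝ _ _)
        + ((fderiv ℝ (D.A K) p.1).comp (ContinuousLinearMap.fst ℝ (Base ι) (ι → ℝ))).flip p.1))) p :=
  hasFDerivAt_fst.prodMk <| hasFDerivAt_pi.2 fun K =>
    ((hasFDerivAt_A hp K).clm_apply hasFDerivAt_fst).neg

/-- The Koszul formula for `E = 2 X₀`, with `X₀` horizontal. The derivatives of the connection forms
combine to the curvature. -/
theorem covDeriv_scaleLift (v z : Total ι) :
    D.covDeriv (fun q => (2 : ℝ) • D.scaleLift q) p v z =
      2 * ∑ I, ∑ J, D.U p.1 I J * (v.1 I ⬝ᵥ z.1 J)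
      + ∑ I, ∑ J, D.dU p.1 p.1 I J * (v.1 I ⬝ᵥ z.1 J)
      + ∑ I, ∑ J, (D.dU p.1 v.1 I J * (p.1 I ⬝ᵥ z.1 J)
        - D.dU p.1 z.1 I J * (v.1 I ⬝ᵥ p.1 J))
      + ∑ I, ∑ J, D.dUinv p.1 p.1 I J * (D.eta I p v * D.eta J p z)
      + ∑ I, ∑ J, (D.U p.1)⁻¹ I J * (D.curv I p.1 p.1 v.1 * D.eta J p z
        + D.eta I p v * D.curv J p.1 p.1 z.1) := by
  have hE := fun K => D.eta_two_smul_scaleLift K p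
  have hd : fderiv ℝ (fun q => (2 : ℝ) • D.scaleLift q) p v
      = ((2 : ℝ) • v.1, fun K => -2 * (D.A K p.1 v.1 + fderiv ℝ (D.A K) p.1 v.1 p.1)) := by
    rw [((hasFDerivAt_scaleLift hp).fun_const_smul (2 : ℝ)).fderiv]
    refine Prod.ext ?_ (funext fun K => ?_)
    · simp
    · simp
      ring
  have heta : ∀ K, D.eta K p (fderiv ℝ (fun q => (2 : ℝ) • D.scaleLift q) p v)
      = -2 * fderiv ℝ (D.A K) p.1 v.1 p.1 := by
    intro K
    rw [hd, eta]
    simp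
    ring
  rw [covDeriv, fderiv_metric hp, fderiv_metric hp, fderiv_metric hp, metric]
  simp only [heta, hE]
  simp only [hd]
  simp only [scaleLift, Prod.smul_fst, Pi.smul_apply, smul_dotProduct, dotProduct_smul, dU, dUinv,
    map_smul, smul_apply, smul_eq_mul, curv]
  simp only [Finset.mul_sum, ← Finset.sum_add_distrib, ← Finset.sum_sub_distrib]
  refine Finset.sum_congr rfl fun I _ => Finset.sum_congr rfl fun J _ => ?_
  ring

/-- Under the constraints the horizontal lift of the generator of scalings is half of a homothetic
Euler vector field. -/
theorem covDeriv_scaleLift_eq_metric (h : D.HiggsConstraints) (v z : Total ι) :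
    D.covDeriv (fun q => (2 : ℝ) • D.scaleLift q) p v z = D.metric p v z := by
  have hrot := fun I J => (D.dU_rotField_eq_zero_iff p.1 I J).1 (h p.1 hp I J).1
  have hscale : ∀ I J, D.dU p.1 p.1 I J = -D.U p.1 I J := fun I J => (h p.1 hp I J).2
  have hcurv := curv_scaleField_eq_zero hp h
  rw [covDeriv_scaleLift hp, sum_dU_dot_sub hp, metric]
  simp only [hrot _ _ _ _, hscale, hcurv, dUinv_scaleField hp hscale, sub_self, zero_mul, mul_zero,
    add_zero, Finset.sum_const_zero, neg_mul, Finset.sum_neg_distrib]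
  ring

/-- Evaluation on horizontal vectors recovers the constraints from the homothetic Euler condition. -/
theorem higgs_of_covDeriv (h : ∀ v z,
    D.covDeriv (fun q => (2 : ℝ) • D.scaleLift q) p v z = D.metric p v z) (I J : ι) :
    (∀ i, D.dU p.1 (rotField i p.1) I J = 0) ∧ D.dU p.1 p.1 I J = -D.U p.1 I J := by
  have hor : ∀ v z : Base ι,
      ∑ I, ∑ J, (D.U p.1 + D.dU p.1 p.1) I J * (v I ⬝ᵥ z J)
      + ∑ K, ∑ J, ∑ a, ∑ b, v K a * z J b * (D.moment p.1 K J b a - D.moment p.1 K J a b) = 0 := by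
    intro v z
    have := h (v, fun K => -D.A K p.1 v) (z, fun K => -D.A K p.1 z)
    rw [covDeriv_scaleLift hp, sum_dU_dot_sub hp, metric] at this
    simp [eta] at this
    simp only [Matrix.add_apply, add_mul, Finset.sum_add_distrib]
    linarith
  -- the first term is symmetric in `v` and `z`, the second one is antisymmetric
  have hsymm : ∀ v z : Base ι, ∑ I, ∑ J, (D.U p.1 + D.dU p.1 p.1) I J * (v I ⬝ᵥ z J)
      = ∑ I, ∑ J, (D.U p.1 + D.dU p.1 p.1) I J * (z I ⬝ᵥ v J) := by
    intro v z
    rw [Finset.sum_comm]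
    refine Finset.sum_congr rfl fun I _ => Finset.sum_congr rfl fun J _ => ?_
    rw [Matrix.add_apply, Matrix.add_apply, dU_comm hp, U_comm hp, dotProduct_comm]
  have hanti : ∀ v z : Base ι,
      ∑ K, ∑ J, ∑ a, ∑ b, v K a * z J b * (D.moment p.1 K J b a - D.moment p.1 K J a b)
      = -∑ K, ∑ J, ∑ a, ∑ b, z K a * v J b *
        (D.moment p.1 K J b a - D.moment p.1 K J a b) := by
    intro v z
    rw [← sum_dU_dot_sub hp, ← sum_dU_dot_sub hp, ← Finset.sum_neg_distrib, Finset.sum_comm]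
    simp only [← Finset.sum_neg_distrib]
    refine Finset.sum_congr rfl fun I _ => Finset.sum_congr rfl fun J _ => ?_
    rw [dU_comm hp v J I, dU_comm hp z J I, dotProduct_comm (p.1 J), dotProduct_comm (v J)]
    ring
  have hzero : ∀ v z : Base ι, ∑ I, ∑ J, (D.U p.1 + D.dU p.1 p.1) I J * (v I ⬝ᵥ z J) = 0 := by
    intro v z
    linarith [hor v z, hor z v, hsymm v z, hanti v z]
  constructor
  · rw [dU_rotField_eq_zero_iff]
    intro a b
    have := hor (Pi.single I (e b)) (Pi.single J (e a))
    rw [hzero, zero_add, Finset.sum_eq_single I (fun K _ hK => by simp [hK]) (by simp),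
      Finset.sum_eq_single J (fun K _ hK => by simp [hK]) (by simp)] at this
    simp [e, Pi.single_apply] at this
    linarith
  · have := hzero (Pi.single I (e 0)) (Pi.single J (e 0))
    rw [Finset.sum_eq_single I (fun K _ hK => by simp [hK]) (by simp),
      Finset.sum_eq_single J (fun K _ hK => by simp [hK]) (by simp)] at this
    simp [e] at this
    linarith

end

end Data

/-! ### Curvature and potential under the constraints -/

/-- The generator `x ↦ x × e_i` of rotations, as a continuous linear map. -/
def rotFieldL {ι : Type*} [Fintype ι] (i : Fin 3) : Base ι →L[ℝ] Base ι :=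
  LinearMap.toContinuousLinearMap <| LinearMap.pi fun I =>
    crossProduct.flip (e i) ∘ₗ (LinearMap.proj I : Base ι →ₗ[ℝ] Fin 3 → ℝ)

theorem rotFieldL_apply {ι : Type*} [Fintype ι] (i : Fin 3) (x : Base ι) :
    rotFieldL i x = rotField i x := rfl

/-- The coordinate function `(x^I)_a` on the total space, as a continuous linear map. -/
def coordL {ι : Type*} (I : ι) (a : Fin 3) : Total ι →L[ℝ] ℝ :=
  (ContinuousLinearMap.proj a : (Fin 3 → ℝ) →L[ℝ] ℝ).comp
    ((ContinuousLinearMap.proj I : Base ι →L[ℝ] Fin 3 → ℝ).comp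
      (ContinuousLinearMap.fst ℝ (Base ι) (ι → ℝ)))

theorem coordL_apply {ι : Type*} (I : ι) (a : Fin 3) (v : Total ι) : coordL I a v = v.1 I a := rfl

theorem hasFDerivAt_coord {ι : Type*} [Fintype ι] (I : ι) (a : Fin 3) (p : Total ι) :
    HasFDerivAt (fun q : Total ι => q.1 I a) (coordL I a) p := (coordL I a).hasFDerivAt

/-- The function `(x^I × u)_a` on the total space, as a continuous linear map. -/
def crossL {ι : Type*} [Fintype ι] (I : ι) (u : Fin 3 → ℝ) (a : Fin 3) : Total ι →L[ℝ] ℝ :=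
  LinearMap.toContinuousLinearMap <| (LinearMap.proj a : (Fin 3 → ℝ) →ₗ[ℝ] ℝ) ∘ₗ
    crossProduct.flip u ∘ₗ (LinearMap.proj I : Base ι →ₗ[ℝ] Fin 3 → ℝ) ∘ₗ
      LinearMap.fst ℝ (Base ι) (ι → ℝ)

theorem crossL_apply {ι : Type*} [Fintype ι] (I : ι) (u : Fin 3 → ℝ) (a : Fin 3) (v : Total ι) :
    crossL I u a v = (v.1 I ⨯₃ u) a := rfl

theorem hasFDerivAt_cross {ι : Type*} [Fintype ι] (I : ι) (u : Fin 3 → ℝ) (a : Fin 3)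
    (p : Total ι) : HasFDerivAt (fun q : Total ι => (q.1 I ⨯₃ u) a) (crossL I u a) p :=
  (crossL I u a).hasFDerivAt

theorem cross_e_apply (u : Fin 3 → ℝ) (i j : Fin 3) : (u ⨯₃ e i) j = ∑ k, eps i j k * u k := by
  fin_cases i <;> fin_cases j <;> simp [Fin.sum_univ_three, eps, e, cross_apply]

theorem rotField_rotField_sub {ι : Type*} (i j : Fin 3) (x : Base ι) :
    rotField j (rotField i x) - rotField i (rotField j x) = ∑ k, eps i j k • rotField k x := by
  funext I a
  simp only [Fin.sum_univ_three, Pi.sub_apply, Pi.add_apply, Pi.smul_apply, smul_eq_mul, rotField]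
  fin_cases i <;> fin_cases j <;> fin_cases a <;>
    simp [eps, e, cross_apply]

namespace Data

variable {ι : Type*} [Fintype ι] [DecidableEq ι] {D : Data ι}

section

variable {x : Base ι} (hx : x ∈ D.S)
include hx

/-- The value of the curvature on two generators of rotations; it accounts for the vertical part of
`[X_i, X_j]`. -/
theorem curv_rotField (h : D.HiggsConstraints) (K : ι) (i j : Fin 3) :
    D.curv K x (rotField i x) (rotField j x) = -∑ k, eps i j k * ∑ J, D.U x K J * x J k := by
  have hscale : ∀ I J, D.dU x x I J = -D.U x I J := fun I J => (h x hx I J).2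
  -- expand `a × (x × e_j)` and contract with the gradient
  have h1 : ∀ I, ∑ J, ∑ l, D.grad x K I J l * (rotField i x I ⨯₃ rotField j x J) l
      = rotField i x I j * D.dU x x K I
        - ∑ J, (rotField i x I ⬝ᵥ x J) * D.grad x K I J j := by
    intro I
    rw [dU_eq_sum, Finset.mul_sum, ← Finset.sum_sub_distrib]
    refine Finset.sum_congr rfl fun J _ => ?_
    generalize rotField i x I = a
    simp only [Fin.sum_univ_three, rotField, dotProduct]
    fin_cases j <;> simp [e, cross_apply] <;> ring
  have h2 : ∑ I, ∑ J, (rotField i x I ⬝ᵥ x J) * D.grad x K I J j = 0 := by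
    -- the scalar triple product is antisymmetric in `I`, `J`, the gradient is symmetric
    have hneg : ∑ I, ∑ J, (rotField i x I ⬝ᵥ x J) * D.grad x K I J j
        = -∑ I, ∑ J, (rotField i x I ⬝ᵥ x J) * D.grad x K I J j := by
      conv_lhs => rw [Finset.sum_comm]
      simp only [← Finset.sum_neg_distrib]
      refine Finset.sum_congr rfl fun I _ => Finset.sum_congr rfl fun J _ => ?_
      rw [grad_comm' hx K J I, ← neg_mul]
      congr 1
      simp only [rotField]
      fin_cases i <;> simp [e, cross_apply, dotProduct, Fin.sum_univ_three] <;> ring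
    linarith
  rw [curv_eq_sum hx]
  simp only [h1, Finset.sum_sub_distrib, h2, hscale, sub_zero]
  simp only [rotField, cross_e_apply, Finset.sum_mul, Finset.mul_sum]
  rw [Finset.sum_comm, ← Finset.sum_neg_distrib]
  refine Finset.sum_congr rfl fun k _ => ?_
  rw [← Finset.sum_neg_distrib]
  exact Finset.sum_congr rfl fun I _ => by ring

/-- In the derivative of `U_{IJ} x^I · x^J`, the derivative of `U_{IJ}` cancels half of the derivative
of `x^I · x^J`. -/
theorem sum_dU_dot_self (h : D.HiggsConstraints) (v : Base ι) :
    ∑ I, ∑ J, D.dU x v I J * (x I ⬝ᵥ x J) = -∑ I, ∑ J, D.U x I J * (v I ⬝ᵥ x J) := by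
  have hrot := fun I J => (D.dU_rotField_eq_zero_iff x I J).1 (h x hx I J).1
  have hscale : ∀ I J, D.dU x x I J = -D.U x I J := fun I J => (h x hx I J).2
  have := sum_dU_dot_sub hx v x
  simp only [hrot _ _ _ _, hscale, sub_self, mul_zero, Finset.sum_const_zero, neg_mul,
    sub_neg_eq_add, Finset.sum_add_distrib] at this
  linarith

/-- The identity that makes `½ d(dκ I_i)` reproduce the Kähler form `Ω_i`. For each pair `K, J` of
indices it is `(Mv) × w + v × (Mw) + M(v × w) = tr(M) v × w` for the symmetric `3 × 3` matrix `M` of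
moments, whose trace is `-U_{KJ}`. -/
theorem sum_dU_cross (h : D.HiggsConstraints) (i : Fin 3) (v w : Base ι) :
    ∑ I, ∑ J, D.dU x v I J * (x I ⨯₃ w J) i - ∑ I, ∑ J, D.dU x w I J * (x I ⨯₃ v J) i
      + ∑ K, x K i * D.curv K x v w = -∑ I, ∑ J, D.U x I J * (v I ⨯₃ w J) i := by
  have hrot := fun I J => (D.dU_rotField_eq_zero_iff x I J).1 (h x hx I J).1
  have hscale : ∀ I J, D.U x I J = -∑ a, D.moment x I J a a := fun I J => by
    rw [← dU_scaleField, show D.dU x x I J = -D.U x I J from (h x hx I J).2, neg_neg]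
  -- a triple product, so that `sum_dU_dot` applies with `z^J = w^J × e_i`
  have htriple : ∀ u v : Fin 3 → ℝ, (u ⨯₃ v) i = u ⬝ᵥ (v ⨯₃ e i) := by
    intro u v
    fin_cases i <;> simp [e, cross_apply, dotProduct, Fin.sum_univ_three] <;> ring
  have h1 : ∀ v w : Base ι, ∑ I, ∑ J, D.dU x v I J * (x I ⨯₃ w J) i
      = ∑ K, ∑ J, ∑ a, ∑ b, v K a * (w J ⨯₃ e i) b * D.moment x K J b a := by
    intro v w
    rw [← sum_dU_dot hx v (fun J => w J ⨯₃ e i)]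
    simp only [htriple]
  have h2 : ∑ K, x K i * D.curv K x v w
      = ∑ I, ∑ J, ∑ l, D.moment x I J i l * (v I ⨯₃ w J) l := by
    have h3 : ∀ K, x K i * D.curv K x v w
        = ∑ I, ∑ J, ∑ l, x K i * D.grad x I J K l * (v I ⨯₃ w J) l := by
      intro K
      rw [curv_eq_sum hx, Finset.mul_sum]
      refine Finset.sum_congr rfl fun I _ => ?_
      rw [Finset.mul_sum]
      refine Finset.sum_congr rfl fun J _ => ?_
      rw [Finset.mul_sum]
      refine Finset.sum_congr rfl fun l _ => ?_
      rw [grad_comm hx, grad_comm' hx]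
      ring
    simp only [h3]
    rw [Finset.sum_comm]
    refine Finset.sum_congr rfl fun I _ => ?_
    rw [Finset.sum_comm]
    refine Finset.sum_congr rfl fun J _ => ?_
    rw [Finset.sum_comm]
    refine Finset.sum_congr rfl fun l _ => ?_
    rw [moment, Finset.sum_mul]
  rw [h1, h1, h2, Finset.sum_comm (f := fun K J => ∑ a, ∑ b,
    w K a * (v J ⨯₃ e i) b * D.moment x K J b a)]
  simp only [← Finset.sum_sub_distrib, ← Finset.sum_add_distrib, ← Finset.sum_neg_distrib]
  refine Finset.sum_congr rfl fun K _ => Finset.sum_congr rfl fun J _ => ?_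
  rw [hscale]
  simp only [moment_comm hx J K]
  have h01 := hrot K J 0 1
  have h02 := hrot K J 0 2
  have h12 := hrot K J 1 2
  simp only [Fin.sum_univ_three]
  fin_cases i <;> simp [e, cross_apply, h01, h02, h12] <;> ring

end

section

variable {p : Total ι} (hp : p ∈ D.N)
include hp

theorem fderiv_potential (h : D.HiggsConstraints) (v : Total ι) :
    fderiv ℝ D.potential p v = D.metric p ((2 : ℝ) • D.scaleLift p) v := by
  have hdot : ∀ I J, HasFDerivAt (fun q : Total ι => q.1 I ⬝ᵥ q.1 J) (∑ a, _) p := fun I J =>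
    HasFDerivAt.fun_sum fun a _ => (hasFDerivAt_coord I a p).mul (hasFDerivAt_coord J a p)
  have hκ : HasFDerivAt D.potential _ p := (HasFDerivAt.fun_sum fun I _ =>
    HasFDerivAt.fun_sum fun J _ => (hasFDerivAt_U hp I J).mul (hdot I J)).const_mul 2
  have h1 : fderiv ℝ D.potential p v = 2 * ∑ I, ∑ J, (D.U p.1 I J * (p.1 I ⬝ᵥ v.1 J)
      + D.U p.1 I J * (v.1 I ⬝ᵥ p.1 J) + D.dU p.1 v.1 I J * (p.1 I ⬝ᵥ p.1 J)) := by
    rw [hκ.fderiv]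
    simp only [sum_apply, smul_apply, smul_eq_mul]
    refine congrArg _ (Finset.sum_congr rfl fun I _ => Finset.sum_congr rfl fun J _ => ?_)
    simp [dU, coordL_apply, dotProduct, Fin.sum_univ_three]
    ring
  have heta := fun K => D.eta_two_smul_scaleLift K p
  rw [h1, metric]
  simp only [Finset.sum_add_distrib, sum_dU_dot_self hp h, heta]
  simp [scaleLift, Finset.mul_sum]
  exact Finset.sum_congr rfl fun I _ => Finset.sum_congr rfl fun J _ => by ring

/-- The 1-form `dκ I_i = Ω_i(E, ·)` in coordinates. -/
theorem fderiv_potential_cplx (h : D.HiggsConstraints) (i : Fin 3) (u : Total ι) :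
    fderiv ℝ D.potential p (D.cplx i p u) =
      -2 * (∑ I, ∑ J, D.U p.1 I J * (p.1 I ⨯₃ u.1 J) i + ∑ K, p.1 K i * D.eta K p u) := by
  have heta := fun K => D.eta_two_smul_scaleLift K p
  have hsymm := sum_U_cross_swap hp i p.1 u.1
  rw [fderiv_potential hp h, ← D.Omega_eq_metric_cplx i hp, Omega]
  simp only [heta, crossWedge, mul_zero, sub_zero]
  simp [scaleLift, mul_sub, Finset.sum_sub_distrib]
  simp only [mul_left_comm _ (2 : ℝ), mul_assoc, ← Finset.mul_sum, hsymm]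
  ring

theorem Omega_eq_d₁ (h : D.HiggsConstraints) (i : Fin 3) (v w : Total ι) :
    D.Omega i p v w
      = 1 / 2 * d₁ (fun q u => fderiv ℝ D.potential q (D.cplx i q u)) p v w := by
  have hd : ∀ u c : Total ι, fderiv ℝ (fun q => fderiv ℝ D.potential q (D.cplx i q u)) p c =
      -2 * (∑ I, ∑ J, (D.U p.1 I J * (c.1 I ⨯₃ u.1 J) i + D.dU p.1 c.1 I J * (p.1 I ⨯₃ u.1 J) i)
        + ∑ K, (p.1 K i * fderiv ℝ (D.A K) p.1 c.1 u.1 + c.1 K i * D.eta K p u)) := by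
    intro u c
    have heq : (fun q => fderiv ℝ D.potential q (D.cplx i q u)) =ᶠ[nhds p] fun q =>
        -2 * (∑ I, ∑ J, D.U q.1 I J * (q.1 I ⨯₃ u.1 J) i + ∑ K, q.1 K i * D.eta K q u) := by
      filter_upwards [D.isOpen_N.mem_nhds hp] with q hq using fderiv_potential_cplx hq h i u
    have hβ : HasFDerivAt (fun q =>
        -2 * (∑ I, ∑ J, D.U q.1 I J * (q.1 I ⨯₃ u.1 J) i + ∑ K, q.1 K i * D.eta K q u)) _ p :=
      (HasFDerivAt.fun_add (HasFDerivAt.fun_sum fun I _ => HasFDerivAt.fun_sum fun J _ =>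
        (hasFDerivAt_U hp I J).mul (hasFDerivAt_cross I (u.1 J) i p)) (HasFDerivAt.fun_sum fun K _ =>
        (hasFDerivAt_coord K i p).mul (hasFDerivAt_eta hp K u))).const_mul (-2)
    rw [heq.fderiv_eq, hβ.fderiv]
    simp only [sum_apply, smul_apply, add_apply, smul_eq_mul]
    refine congrArg _ (congrArg₂ (· + ·) (Finset.sum_congr rfl fun I _ =>
      Finset.sum_congr rfl fun J _ => ?_) (Finset.sum_congr rfl fun K _ => ?_))
    · simp [dU, crossL_apply]
      ring
    · simp [coordL_apply]
      ring
  have hsymm := sum_U_cross_swap hp i v.1 w.1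
  have key := sum_dU_cross hp h i v.1 w.1
  rw [d₁, hd, hd, Omega]
  simp only [crossWedge, curv, mul_sub, Finset.sum_sub_distrib, Finset.sum_add_distrib, hsymm]
    at key ⊢
  linarith

theorem fderiv_rotLift (i : Fin 3) (c : Total ι) : fderiv ℝ (D.rotLift i) p c =
    (rotField i c.1, fun K => -∑ J, (D.dU p.1 c.1 K J * p.1 J i + D.U p.1 K J * c.1 J i)
      - (fderiv ℝ (D.A K) p.1 c.1 (rotField i p.1) + D.A K p.1 (rotField i c.1))) := by
  have hr : HasFDerivAt (fun q : Total ι => rotField i q.1)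
      ((rotFieldL i).comp (ContinuousLinearMap.fst ℝ (Base ι) (ι → ℝ))) p :=
    ((rotFieldL i).comp (ContinuousLinearMap.fst ℝ (Base ι) (ι → ℝ))).hasFDerivAt
  have h : HasFDerivAt (D.rotLift i) _ p := hr.prodMk <| hasFDerivAt_pi.2 fun K =>
    ((HasFDerivAt.fun_sum fun J _ =>
      (hasFDerivAt_U hp K J).mul (hasFDerivAt_coord J i p)).fun_neg).fun_sub
      ((hasFDerivAt_A hp K).clm_apply hr)
  rw [h.fderiv]
  refine Prod.ext (by simp [rotFieldL_apply]) (funext fun K => ?_)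
  simp [rotFieldL_apply, dU, coordL_apply]
  simp only [add_comm, mul_comm]

theorem fderiv_scaleLift (c : Total ι) : fderiv ℝ D.scaleLift p c =
    (c.1, fun K => -(fderiv ℝ (D.A K) p.1 c.1 p.1 + D.A K p.1 c.1)) := by
  rw [(hasFDerivAt_scaleLift hp).fderiv]
  refine Prod.ext (by simp) (funext fun K => ?_)
  simp
  ring

theorem lieBracket_rotLift (h : D.HiggsConstraints) (i j : Fin 3) :
    VectorField.lieBracket ℝ (D.rotLift i) (D.rotLift j) p = ∑ k, eps i j k • D.rotLift k p := by
  have hrot : ∀ i I J, D.dU p.1 (rotField i p.1) I J = 0 := fun i I J => (h p.1 hp I J).1 i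
  have hc := rotField_rotField_sub i j p.1
  rw [VectorField.lieBracket, fderiv_rotLift hp, fderiv_rotLift hp]
  refine Prod.ext ?_ (funext fun K => ?_)
  · simpa [rotLift, Prod.fst_sum] using hc
  · have hA := congrArg (D.A K p.1) hc
    have hk := curv_rotField hp h K i j
    have heps : ∀ k, eps j i k = -eps i j k := fun k => by
      rw [eps, ← cross_anticomm, Pi.neg_apply, eps]
    have hsum : ∀ i j, ∑ J, D.U p.1 K J * rotField i p.1 J j
        = ∑ k, eps i j k * ∑ J, D.U p.1 K J * p.1 J k := by
      intro i j
      simp only [rotField, cross_e_apply, Finset.mul_sum]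
      rw [Finset.sum_comm]
      exact Finset.sum_congr rfl fun k _ => Finset.sum_congr rfl fun J _ => by ring
    simp only [rotLift, hrot, zero_mul, zero_add, hsum, heps, neg_mul, Finset.sum_neg_distrib,
      Prod.snd_sub, Pi.sub_apply, Prod.snd_sum, Finset.sum_apply, Prod.smul_snd, Pi.smul_apply,
      smul_eq_mul, mul_sub, mul_neg, Finset.sum_sub_distrib]
    simp only [map_sub, map_sum, map_smul, smul_eq_mul] at hA
    rw [curv] at hk
    linarith

theorem lieBracket_rotLift_scaleLift (h : D.HiggsConstraints) (i : Fin 3) :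
    VectorField.lieBracket ℝ (D.rotLift i) D.scaleLift p = 0 := by
  have hscale : ∀ I J, D.dU p.1 p.1 I J = -D.U p.1 I J := fun I J => (h p.1 hp I J).2
  rw [VectorField.lieBracket, fderiv_rotLift hp, fderiv_scaleLift hp]
  refine Prod.ext (by simp [rotLift, scaleLift]) (funext fun K => ?_)
  have := curv_scaleField_eq_zero hp h K (rotField i p.1)
  simp [rotLift, scaleLift, hscale]
  simp [curv] at this
  linarith

end

end Data

/-! ### The collective action of the quaternions -/

/-- A vector of `ℝ³` as an imaginary quaternion. -/
def toImQuat (v : Fin 3 → ℝ) : ℍ[ℝ] := ⟨0, v 0, v 1, v 2⟩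

@[simp] theorem toImQuat_re (v : Fin 3 → ℝ) : (toImQuat v).re = 0 := rfl
@[simp] theorem toImQuat_imI (v : Fin 3 → ℝ) : (toImQuat v).imI = v 0 := rfl
@[simp] theorem toImQuat_imJ (v : Fin 3 → ℝ) : (toImQuat v).imJ = v 1 := rfl
@[simp] theorem toImQuat_imK (v : Fin 3 → ℝ) : (toImQuat v).imK = v 2 := rfl

/-- Conjugation of quaternions as a continuous linear map. -/
def conjL : ℍ[ℝ] →L[ℝ] ℍ[ℝ] :=
  LinearMap.toContinuousLinearMap
    { toFun := star
      map_add' := star_add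
      map_smul' := fun c q => by ext <;> simp }

theorem conjL_apply (q : ℍ[ℝ]) : conjL q = star q := rfl

/-- The imaginary part of a quaternion as a vector of `ℝ³`. -/
def imVecL : ℍ[ℝ] →L[ℝ] (Fin 3 → ℝ) :=
  LinearMap.toContinuousLinearMap
    { toFun := fun q => ![q.imI, q.imJ, q.imK]
      map_add' := fun q r => by ext a; fin_cases a <;> simp
      map_smul' := fun c q => by ext a; fin_cases a <;> simp }

theorem imVecL_apply (q : ℍ[ℝ]) : imVecL q = ![q.imI, q.imJ, q.imK] := rfl

theorem collectiveAct_apply {ι : Type*} (q : ℍ[ℝ]) (x : Base ι) (I : ι) :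
    collectiveAct q x I = imVecL (star q * toImQuat (x I) * q) := rfl

theorem toImQuat_collectiveAct {ι : Type*} (q : ℍ[ℝ]) (x : Base ι) (I : ι) :
    toImQuat (collectiveAct q x I) = star q * toImQuat (x I) * q := by
  ext <;> simp [collectiveAct_apply, imVecL_apply]
  ring

theorem collectiveAct_one {ι : Type*} (x : Base ι) : collectiveAct 1 x = x := by
  funext I a
  fin_cases a <;> simp [collectiveAct_apply, imVecL_apply]

/-- For an imaginary quaternion `v`, `k̄ v + v k = 2 Re(k) v + 2 v × Im(k)`. -/
theorem imVecL_anticomm (k : ℍ[ℝ]) (v : Fin 3 → ℝ) :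
    imVecL (star k * toImQuat v + toImQuat v * k)
      = (2 * k.re) • v + ∑ i, (2 * imVecL k i) • (v ⨯₃ e i) := by
  funext a
  fin_cases a <;> simp [imVecL_apply, Fin.sum_univ_three, e, cross_apply, Matrix.vecHead,
    Matrix.vecTail] <;> ring

/-- Because `r ↦ r̄ x r` is a right action, its derivative at `q` in the direction `q k` is the
infinitesimal action of `k` at the point `q̄ x q`. -/
theorem hasFDerivAt_collectiveAct {ι : Type*} [Fintype ι] (q : ℍ[ℝ]) (x : Base ι) :
    ∃ L : ℍ[ℝ] →L[ℝ] Base ι, HasFDerivAt (fun r => collectiveAct r x) L q ∧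
      ∀ k, L (q * k) = (2 * k.re) • collectiveAct q x
        + ∑ i, (2 * imVecL k i) • rotField i (collectiveAct q x) := by
  have h : ∀ I, HasFDerivAt (fun r : ℍ[ℝ] => imVecL (star r * toImQuat (x I) * r)) _ q := fun I =>
    imVecL.hasFDerivAt.comp q
      (((conjL.hasFDerivAt (x := q)).mul_const' (toImQuat (x I))).mul'
        (hasFDerivAt_id q))
  refine ⟨_, hasFDerivAt_pi.2 h, fun k => funext fun I => ?_⟩
  have := imVecL_anticomm k (collectiveAct q x I)
  rw [toImQuat_collectiveAct] at this
  simp only [rotField, Pi.add_apply, Finset.sum_apply, Pi.smul_apply]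
  rw [← this]
  simp [conjL_apply, mul_assoc, add_comm]

theorem contDiff_coord {ι : Type*} [Fintype ι] (I : ι) (a : Fin 3) :
    ContDiff ℝ ∞ (fun q : Total ι => q.1 I a) := (coordL I a).contDiff

namespace Data

variable {ι : Type*} [Fintype ι] [DecidableEq ι] {D : Data ι}

/-- The derivative of `q ↦ |q|² U_{IJ}(q̄ x q)` at `q` in the direction `q k` is a combination of the
quantities that vanish under the constraints, at the point `q̄ x q`. -/
theorem hasFDerivAt_normSq_mul_U (x : Base ι) (q : ℍ[ℝ]) (hx : collectiveAct q x ∈ D.S) (I J : ι) :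
    ∃ L : ℍ[ℝ] →L[ℝ] ℝ,
      HasFDerivAt (fun r : ℍ[ℝ] => ‖r‖ ^ 2 * D.U (collectiveAct r x) I J) L q ∧
      ∀ k, L (q * k) = 2 * ‖q‖ ^ 2 * (k.re * (D.U (collectiveAct q x) I J
          + D.dU (collectiveAct q x) (collectiveAct q x) I J)
        + ∑ i, imVecL k i * D.dU (collectiveAct q x) (rotField i (collectiveAct q x)) I J) := by
  obtain ⟨L, hL, hLk⟩ := hasFDerivAt_collectiveAct q x
  have hU := (differentiableAt_U hx I J).hasFDerivAt.comp q hL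
  have h := ((hasFDerivAt_id q).norm_sq).mul hU
  refine ⟨_, h, fun k => ?_⟩
  have hin : inner ℝ q (q * k) = ‖q‖ ^ 2 * k.re := by
    rw [real_inner_comm, Quaternion.inner_def, sq, ← Quaternion.normSq_eq_norm_mul_self,
      Quaternion.normSq_def']
    simp
    ring
  simp [hLk, hin, dU, Fin.sum_univ_three]
  ring

theorem higgsConstraints_iff_higgsEquivariant (hS : D.BaseInvariant) :
    D.HiggsConstraints ↔ D.HiggsEquivariant := by
  constructor
  · intro h q hq x hx
    ext I J
    have hpre : IsPreconnected ({0}ᶜ : Set ℍ[ℝ]) :=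
      (isConnected_compl_singleton_of_one_lt_rank (by
        rw [Quaternion.rank_eq_four]; norm_num) 0).isPreconnected
    have hd : ∀ r ∈ ({0}ᶜ : Set ℍ[ℝ]),
        HasFDerivAt (fun r : ℍ[ℝ] => ‖r‖ ^ 2 * D.U (collectiveAct r x) I J) (0 : ℍ[ℝ] →L[ℝ] ℝ) r := by
      intro r hr
      obtain ⟨L, hL, hLk⟩ := hasFDerivAt_normSq_mul_U x r (hS r hr x hx) I J
      suffices hL0 : L = 0 from hL0 ▸ hL
      refine ContinuousLinearMap.ext fun k => ?_
      have hk := hLk (r⁻¹ * k)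
      have hrot : ∀ i, D.dU (collectiveAct r x) (rotField i (collectiveAct r x)) I J = 0 :=
        fun i => (h _ (hS r hr x hx) I J).1 i
      have hscale : D.dU (collectiveAct r x) (collectiveAct r x) I J
          = -D.U (collectiveAct r x) I J := (h _ (hS r hr x hx) I J).2
      rw [mul_inv_cancel_left₀ hr, hscale] at hk
      simpa [hrot] using hk
    have heq := isOpen_compl_singleton.is_const_of_fderiv_eq_zero hpre
      (fun r hr => (hd r hr).differentiableAt.differentiableWithinAt)
      (fun r hr => (hd r hr).fderiv) hq (one_ne_zero : (1 : ℍ[ℝ]) ≠ 0)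
    simp only [collectiveAct_one, norm_one, one_pow, one_mul] at heq
    rw [Matrix.smul_apply, smul_eq_mul, ← heq, inv_mul_cancel_left₀ (by simpa using hq)]
  · intro h x hx I J
    obtain ⟨L, hL, hLk⟩ := hasFDerivAt_normSq_mul_U x 1 (by rwa [collectiveAct_one]) I J
    have heq : (fun r : ℍ[ℝ] => ‖r‖ ^ 2 * D.U (collectiveAct r x) I J)
        =ᶠ[nhds 1] fun _ => D.U x I J := by
      filter_upwards [isOpen_compl_singleton.mem_nhds (one_ne_zero : (1 : ℍ[ℝ]) ≠ 0)] with r hr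
      rw [h r hr x hx, Matrix.smul_apply, smul_eq_mul, mul_inv_cancel_left₀ (by simpa using hr)]
    have hL0 : L = 0 := hL.unique ((hasFDerivAt_const _ _).congr_of_eventuallyEq heq)
    simp only [hL0, zero_apply, collectiveAct_one, one_mul, norm_one, one_pow, mul_one] at hLk
    change (∀ i, D.dU x (rotField i x) I J = 0) ∧ D.dU x x I J = -D.U x I J
    constructor
    · intro i
      have := hLk (toImQuat (e i))
      fin_cases i <;> simpa [imVecL_apply, e, Fin.sum_univ_three] using this
    · have := hLk 1
      simp [imVecL_apply, Fin.sum_univ_three] at this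
      linarith

/-! ### Lifts of the collective action -/

theorem covDeriv_congr {X Y : Total ι → Total ι} {p : Total ι} (h : X =ᶠ[nhds p] Y) :
    D.covDeriv X p = D.covDeriv Y p := by
  funext v z
  rw [covDeriv, covDeriv, h.fderiv_eq, h.eq_of_nhds]

/-- A lift to a cone structure is unique. -/
theorem lift_eq_scaleLift {X₀ : Total ι → Total ι} {X : Fin 3 → Total ι → Total ι}
    (hl : D.IsLift X₀ X) (hc : D.GeneratesCone X₀ X) : ∀ p ∈ D.N, X₀ p = D.scaleLift p :=
  fun p hp => eq_scaleLift_of_cplx hp (hl.proj_zero p hp) fun i => by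
    rw [← hc.companion i p hp, hl.proj i p hp]

theorem lift_eq_rotLift {X₀ : Total ι → Total ι} {X : Fin 3 → Total ι → Total ι}
    (hl : D.IsLift X₀ X) (hc : D.GeneratesCone X₀ X) (i : Fin 3) :
    ∀ p ∈ D.N, X i p = D.rotLift i p := fun p hp => by
  rw [hc.companion i p hp, lift_eq_scaleLift hl hc p hp, neg_cplx_scaleLift]

theorem contDiffOn_U (I J : ι) : ContDiffOn ℝ ∞ (fun q : Total ι => D.U q.1 I J) D.N :=
  (D.smooth_U I J).comp contDiff_fst.contDiffOn fun _ hq => hq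

theorem contDiffOn_A (K : ι) : ContDiffOn ℝ ∞ (fun q : Total ι => D.A K q.1) D.N :=
  (D.smooth_A K).comp contDiff_fst.contDiffOn fun _ hq => hq

theorem contDiffOn_potential : ContDiffOn ℝ ∞ D.potential D.N := by
  refine contDiffOn_const.mul (ContDiffOn.sum fun I _ => ContDiffOn.sum fun J _ =>
    (contDiffOn_U I J).mul (ContDiffOn.sum fun a _ => ?_))
  exact ((contDiff_coord I a).mul (contDiff_coord J a)).contDiffOn

theorem contDiffOn_scaleLift : ContDiffOn ℝ ∞ D.scaleLift D.N :=
  contDiff_fst.contDiffOn.prodMk <| contDiffOn_pi.2 fun K =>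
    ((contDiffOn_A K).clm_apply contDiff_fst.contDiffOn).neg

theorem contDiffOn_rotLift (i : Fin 3) : ContDiffOn ℝ ∞ (D.rotLift i) D.N := by
  have hr : ContDiffOn ℝ ∞ (fun q : Total ι => rotField i q.1) D.N :=
    ((rotFieldL i).comp (ContinuousLinearMap.fst ℝ (Base ι) (ι → ℝ))).contDiff.contDiffOn
  refine hr.prodMk <| contDiffOn_pi.2 fun K => ContDiffOn.sub (ContDiffOn.neg
    (ContDiffOn.sum fun J _ => (contDiffOn_U K J).mul (contDiff_coord J i).contDiffOn))
    ((contDiffOn_A K).clm_apply hr)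

theorem isLift_scaleLift_rotLift : D.IsLift D.scaleLift D.rotLift where
  smooth_zero := contDiffOn_scaleLift
  smooth := contDiffOn_rotLift
  proj_zero _ _ := rfl
  proj _ _ _ := rfl

theorem generatesCone_scaleLift_rotLift (h : D.HiggsConstraints) :
    D.GeneratesCone D.scaleLift D.rotLift where
  euler _ hp := covDeriv_scaleLift_eq_metric hp h
  companion i p _ := (D.neg_cplx_scaleLift i p).symm

theorem higgsConstraints_of_generatesCone {X₀ : Total ι → Total ι}
    {X : Fin 3 → Total ι → Total ι} (hl : D.IsLift X₀ X) (hc : D.GeneratesCone X₀ X) :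
    D.HiggsConstraints := by
  intro x hx I J
  have hp : ((x, 0) : Total ι) ∈ D.N := hx
  refine higgs_of_covDeriv hp (fun v z => ?_) I J
  rw [← hc.euler _ hp v z]
  refine congrFun (congrFun (covDeriv_congr ?_) v) z
  filter_upwards [D.isOpen_N.mem_nhds hp] with q hq
  rw [lift_eq_scaleLift hl hc q hq]

theorem satisfiesAlgebra_of_generatesCone {X₀ : Total ι → Total ι}
    {X : Fin 3 → Total ι → Total ι} (hl : D.IsLift X₀ X) (hc : D.GeneratesCone X₀ X) :
    D.SatisfiesAlgebra X₀ X := by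
  have h := higgsConstraints_of_generatesCone hl hc
  intro p hp
  have h₀ : X₀ =ᶠ[nhds p] D.scaleLift := by
    filter_upwards [D.isOpen_N.mem_nhds hp] with q hq using lift_eq_scaleLift hl hc q hq
  have h₁ : ∀ i, X i =ᶠ[nhds p] D.rotLift i := fun i => by
    filter_upwards [D.isOpen_N.mem_nhds hp] with q hq using lift_eq_rotLift hl hc i q hq
  refine ⟨fun i j => ?_, fun i => ?_⟩
  · rw [(h₁ i).lieBracket_vectorField_eq (h₁ j), lieBracket_rotLift hp h]
    exact Finset.sum_congr rfl fun k _ => by rw [(h₁ k).eq_of_nhds]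
  · rw [(h₁ i).lieBracket_vectorField_eq h₀, lieBracket_rotLift_scaleLift hp h]

theorem isPotentialOfCone_potential {X₀ : Total ι → Total ι}
    {X : Fin 3 → Total ι → Total ι} (hl : D.IsLift X₀ X) (hc : D.GeneratesCone X₀ X) :
    D.IsPotentialOfCone (fun p => (2 : ℝ) • X₀ p) D.potential := by
  have h := higgsConstraints_of_generatesCone hl hc
  refine ⟨⟨contDiffOn_potential, fun i p hp => Omega_eq_d₁ hp h i⟩, fun p hp v => ?_, fun p hp => ?_⟩
  · simp only [fderiv_potential hp h, lift_eq_scaleLift hl hc p hp]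
  · simp only [lift_eq_scaleLift hl hc p hp, metric, eta_two_smul_scaleLift]
    simp [scaleLift, potential, Finset.mul_sum]
    exact Finset.sum_congr rfl fun I _ => Finset.sum_congr rfl fun J _ => by ring

end Data

end ExtGH

end

theorem proposition4p1 {ι : Type*} [Fintype ι] [DecidableEq ι] (D : ExtGH.Data ι) :
    -- the collective action lifts to a hyperkähler cone structure iff the constraints hold
    ((∃ X₀ X, D.IsLift X₀ X ∧ D.GeneratesCone X₀ X) ↔ D.HiggsConstraints) ∧
    -- any such lift is an infinitesimal action, with the stated hyperkähler potential
    (∀ X₀ X, D.IsLift X₀ X → D.GeneratesCone X₀ X →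
      D.SatisfiesAlgebra X₀ X ∧
      D.IsPotentialOfCone (fun p => (2 : ℝ) • X₀ p) D.potential) ∧
    -- the constraints express rotation invariance and homogeneity of degree -1
    (D.BaseInvariant → (D.HiggsConstraints ↔ D.HiggsEquivariant)) :=
  ⟨⟨fun ⟨_, _, hl, hc⟩ => ExtGH.Data.higgsConstraints_of_generatesCone hl hc, fun h =>
      ⟨_, _, ExtGH.Data.isLift_scaleLift_rotLift, ExtGH.Data.generatesCone_scaleLift_rotLift h⟩⟩,
    fun _ _ hl hc => ⟨ExtGH.Data.satisfiesAlgebra_of_generatesCone hl hc,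
      ExtGH.Data.isPotentialOfCone_potential hl hc⟩,
    ExtGH.Data.higgsConstraints_iff_higgsEquivariant⟩
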